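/- **Theorem 4.** *Model.* Let $0\le s<1$ and $0<\gamma\le 1$, let $g=1/\gamma$ and $l=\max\{(1-s)/(3\sqrt2),\ \gamma/\sqrt2\}$. A network is a finite set $V$ of nodes in the Euclidean plane with pairwise distances at least $\gamma$; two nodes are neighbours if their distance lies in $(s,1]$, and the resulting graph is assumed connected, with (hop) diameter $D$. Time is divided into synchronous rounds, and all nodes are awake from the first round. In each round every node is a sender or a receiver. A node receives a packet in a round if and only if it is a receiver, exactly one of its neighbours sends (it receives what that neighbour sends), and no node within distance $s$ of it sends; otherwise it hears only noise, whatever the cause. A node knows $s$, $\gamma$, its own location and what it has heard, but not the network; in addition it is assumed that at any time each node knows which nodes of its own block (defined below) possess the source message $m$. Initially exactly one node, the source, possesses $m$. *Partition.* The plane is partitioned into a mesh of $3\times3$ squares (regions); each region, starting at its Northwest corner, into $\mu=\lceil 3/l\rceil^2$ blocks of size $l\times l$; and each block, starting at its Northwest corner, into $\nu=k^2$ homes of size $\gamma/\sqrt2\times\gamma/\sqrt2$, where $k=\lceil\sqrt2\,l/\gamma\rceil$ (the last blocks and homes of each row and column may be smaller). Every square contains its North and West borders and not its South and East borders. The blocks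 of a region, and the homes of a block, are numbered West to East, row by row, North to South, and the label of a node is the pair (block number, home number). *Algorithm $\mathcal B^2$.* First, neighbourhood discovery $\mathcal D^*$, where each node $u$ keeps a set $N_u$ of labels, initially empty. (i) Procedure $\mathcal D$: for each of the $\mu\nu$ labels $x$ in turn there is one round, in which the nodes with label $x$ send a hello, and every other node $u$ that hears a hello adds $x$ to $N_u$. (ii) For each label $y$, Procedure $\mathcal D_y$: for each label $x$ in turn there is one round, in which the nodes with label $x$ or $y$ send a hello, and every other node $u$ that hears no hello and has $y\in N_u$ adds $x$ to $N_u$. Next, transmission $\mathcal T^2$, in parallel in all regions: an iteration gives each of the $\mu$ block numbers in turn one phase. At the beginning of a phase the spokesmen of each block with this number are determined from the nodes of the block that then possess $m$: they are, for each row, each column and each diagonal (in both directions) of homes of the block, the two such nodes in the homes closest to the two ends of that row, column or diagonal. The phase has one round for every row and end ($E_i,W_i$ for $i=1,\dots,k$), then one for every column and end ($N_i,S_i$ for $i=1,\dots,k$), then one for every diagonal and end ($NE_i,SE_i,NW_i,SW_i$ for $i=1,\dots,2k-1$); in each of these rounds the corresponding spokesman sends $m$, unless it has already sent $m$ before. All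 other nodes listen, and a node that receives $m$ possesses it from then on. Iterations are repeated until no node has transmitted during an iteration; then the algorithm ends. *Claim.* There is an absolute constant $C>0$ such that, for all $s$, $\gamma$, all such connected networks and all sources, Algorithm $\mathcal B^2$ ends, every node possesses $m$ when it ends, and the total number of rounds is at most $$C\left(\frac{D\,g}{l}+g^4\right).$$ -/

import Mathlib

/-! # Broadcasting in the plane under the swamping communication model -/

noncomputable section

namespace Swamping

/-- The Euclidean plane. Coordinate `0` points East, coordinate `1` points North. -/
abbrev Plane : Type := EuclideanSpace ℝ (Fin 2)

/-! ## The communication model -/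

/-- The network on a finite set `V` of nodes (a node is its location): two nodes are neighbours when
their distance is greater than the swamping distance `s` and at most `1`. -/
def network (s : ℝ) (V : Finset Plane) : SimpleGraph V where
  Adj u v := u ≠ v ∧ s < dist (u : Plane) v ∧ dist (u : Plane) v ≤ 1
  symm := ⟨fun u v h => ⟨h.1.symm, by rw [dist_comm]; exact h.2⟩⟩
  loopless := ⟨fun _ h => h.1 rfl⟩

/-- In a round in which node `w` transmits `tx w` (`none`: `w` is a receiver), node `v` receives the
packet `p`: `v` is a receiver, no node within distance `s` of `v` transmits, and exactly one
neighbour of `v` transmits, and it transmits `p`. -/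
def Receives {P : Type*} (s : ℝ) {V : Finset Plane} (tx : V → Option P) (v : V) (p : P) : Prop :=
  tx v = none ∧
  (∀ w : V, dist (w : Plane) v ≤ s → tx w = none) ∧
  ∃ u : V, (network s V).Adj u v ∧ tx u = some p ∧
    ∀ w : V, (network s V).Adj w v → tx w ≠ none → w = u

open Classical in
/-- What `v` hears in a round: a packet, or `none`, i.e. noise (silence, collision and swamping
are indistinguishable). -/
def heard {P : Type*} (s : ℝ) {V : Finset Plane} (tx : V → Option P) (v : V) : Option P :=
  if h : ∃ p, Receives s tx v p then some h.choose else none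

/-- A deterministic synchronous local algorithm for broadcasting a message of type `M`.  All
components are functions of the round number, the node's own location, its own state, and the
side information of type `I` that the node has in that round; the network is not available. -/
structure LocalAlgorithm (M I σ P : Type*) where
  /-- initial state, from the location and the source message (`none` at nodes not the source) -/
  init : Plane → Option M → σ
  /-- local computation at the beginning of a round -/
  update : ℕ → Plane → I → σ → σ
  /-- the packet transmitted in this round, or `none` to be a receiver -/
  send : ℕ → Plane → σ → Option P
  /-- local computation at the end of a round, from what was heard -/
  listen : ℕ → Plane → σ → Option P → σ

section Execution

variable {M I σ P : Type*} (A : LocalAlgorithm M I σ P) (s : ℝ) {V : Finset Plane}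
  (info : (V → σ) → V → I)

/-- The local states in round `t` after the `update` computation, from the states `st` at the
beginning of the round. -/
def updated (t : ℕ) (st : V → σ) : V → σ := fun u => A.update t u (info st u) (st u)

/-- The transmissions of round `t`, from the states `st` at the beginning of the round. -/
def transmissions (t : ℕ) (st : V → σ) : V → Option P :=
  fun u => A.send t u (updated A info t st u)

open Classical in
/-- The states at the beginning of round `t` (after `t` complete rounds), when `src` broadcasts `m`.
All nodes are awake from round `0` on. -/
def states (src : V) (m : M) : ℕ → V → σ
  | 0 => fun u => A.init u (if u = src then some m else none)
  | t + 1 => fun u =>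
      A.listen t u (updated A info t (states src m t) u)
        (heard s (transmissions A info t (states src m t)) u)

end Execution

/-! ## The partition of the plane

Regions are `3 × 3` squares, blocks are `l × l` squares in a region, homes are
`γ/√2 × γ/√2` squares in a block (the last ones in each row and column are cut off).
All squares contain their North and West borders and not their South and East borders, so
positions are measured eastwards and southwards, and the same one-dimensional half-open partition is
used in both directions. Rows are counted southwards, columns eastwards, all labels from `0`. -/

/-- The block length `l`. -/
def blockLen (s γ : ℝ) : ℝ := max ((1 - s) / (3 * √2)) (γ / √2)

/-- Eastward coordinate. -/
def east (p : Plane) : ℝ := p 0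

/-- Southward coordinate. -/
def south (p : Plane) : ℝ := -(p 1)

/-- Index of the region interval `[3i, 3i+3)` of `z`. -/
def regionIdx (z : ℝ) : ℤ := ⌊z / 3⌋

/-- Offset of `z` in its region interval. -/
def regionOff (z : ℝ) : ℝ := z - 3 * regionIdx z

/-- Index of the block interval of `z` in its region interval. -/
def blockIdx (s γ z : ℝ) : ℕ := ⌊regionOff z / blockLen s γ⌋₊

/-- Offset of `z` in its block interval. -/
def blockOff (s γ z : ℝ) : ℝ := regionOff z - blockLen s γ * blockIdx s γ z

/-- Index of the home interval of `z` in its block interval. -/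
def homeIdx (s γ z : ℝ) : ℕ := ⌊blockOff s γ z / (γ / √2)⌋₊

/-- Number of rows (and of columns) of blocks in a region. -/
def blockRows (s γ : ℝ) : ℕ := ⌈3 / blockLen s γ⌉₊

/-- Number of rows (and of columns) of homes in a block. -/
def homeRows (s γ : ℝ) : ℕ := ⌈√2 * blockLen s γ / γ⌉₊

/-- Number `μ` of blocks in a region. -/
def numBlocks (s γ : ℝ) : ℕ := blockRows s γ ^ 2

/-- Number `ν` of homes in a block. -/
def numHomes (s γ : ℝ) : ℕ := homeRows s γ ^ 2

/-- Label of the block of `p` in its region: West to East, row by row, North to South. -/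
def blockLabel (s γ : ℝ) (p : Plane) : ℕ :=
  blockIdx s γ (south p) * blockRows s γ + blockIdx s γ (east p)

/-- Row of the home of `p` in its block. -/
def homeRow (s γ : ℝ) (p : Plane) : ℕ := homeIdx s γ (south p)

/-- Column of the home of `p` in its block. -/
def homeCol (s γ : ℝ) (p : Plane) : ℕ := homeIdx s γ (east p)

/-- Label of the home of `p` in its block: West to East, row by row, North to South. -/
def homeLabel (s γ : ℝ) (p : Plane) : ℕ := homeRow s γ p * homeRows s γ + homeCol s γ p

/-- The (block, home) label of `p`. -/
def label (s γ : ℝ) (p : Plane) : ℕ × ℕ := (blockLabel s γ p, homeLabel s γ p)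

/-- `p` and `q` lie in the same block of the same region. -/
def SameBlock (s γ : ℝ) (p q : Plane) : Prop :=
  regionIdx (east p) = regionIdx (east q) ∧ regionIdx (south p) = regionIdx (south q) ∧
  blockIdx s γ (east p) = blockIdx s γ (east q) ∧ blockIdx s γ (south p) = blockIdx s γ (south q)

/-! ## Spokesmen -/

/-- Spokesman labels: `E`, `W` by row, `N`, `S` by column, `NE`, `SW` by Southwest-Northeast
diagonal, `SE`, `NW` by Southeast-Northwest diagonal. -/
inductive Role where
  | E (i : ℕ) | W (i : ℕ) | N (i : ℕ) | S (i : ℕ)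
  | NE (i : ℕ) | SE (i : ℕ) | NW (i : ℕ) | SW (i : ℕ)

/-- Index of the Southwest-Northeast diagonal of homes through the home of `p`. -/
def antiDiag (s γ : ℝ) (p : Plane) : ℕ := homeRow s γ p + homeCol s γ p

/-- Index of the Southeast-Northwest diagonal of homes through the home of `p`; as
`homeRow s γ p < homeRows s γ`, the subtraction is not truncated. -/
def mainDiag (s γ : ℝ) (p : Plane) : ℕ := homeCol s γ p + (homeRows s γ - 1 - homeRow s γ p)

/-- Given the set `K` of the nodes of a block that possess the message, `p` is the spokesman
of the block for the given role: it is in `K` and, among the nodes of `K` in the same line of homes,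
in the home closest to the given end of the line. -/
def IsSpokesman (s γ : ℝ) (K : Set Plane) (p : Plane) : Role → Prop
  | .E i => p ∈ K ∧ homeRow s γ p = i ∧
      ∀ q ∈ K, homeRow s γ q = i → homeCol s γ q ≤ homeCol s γ p
  | .W i => p ∈ K ∧ homeRow s γ p = i ∧
      ∀ q ∈ K, homeRow s γ q = i → homeCol s γ p ≤ homeCol s γ q
  | .N i => p ∈ K ∧ homeCol s γ p = i ∧
      ∀ q ∈ K, homeCol s γ q = i → homeRow s γ p ≤ homeRow s γ q
  | .S i => p ∈ K ∧ homeCol s γ p = i ∧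
      ∀ q ∈ K, homeCol s γ q = i → homeRow s γ q ≤ homeRow s γ p
  | .NE i => p ∈ K ∧ antiDiag s γ p = i ∧
      ∀ q ∈ K, antiDiag s γ q = i → homeCol s γ q ≤ homeCol s γ p
  | .SW i => p ∈ K ∧ antiDiag s γ p = i ∧
      ∀ q ∈ K, antiDiag s γ q = i → homeCol s γ p ≤ homeCol s γ q
  | .SE i => p ∈ K ∧ mainDiag s γ p = i ∧
      ∀ q ∈ K, mainDiag s γ q = i → homeCol s γ q ≤ homeCol s γ p
  | .NW i => p ∈ K ∧ mainDiag s γ p = i ∧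
      ∀ q ∈ K, mainDiag s γ q = i → homeCol s γ p ≤ homeCol s γ q

/-- The order in which the spokesmen of a block with `k` rows of homes have their turns. -/
def turns (k : ℕ) : List Role :=
  (List.range k).flatMap (fun i => [.E i, .W i]) ++
  (List.range k).flatMap (fun i => [.N i, .S i]) ++
  (List.range (2 * k - 1)).flatMap (fun i => [.NE i, .SE i, .NW i, .SW i])

/-! ## Algorithm `B²` -/

/-- What has to be done in a round. -/
inductive Task where
  /-- Neighbourhood discovery, first part (Procedure `D`): the turn of the label `x`. -/
  | hello (x : ℕ × ℕ)
  /-- Neighbourhood discovery by collisions (Procedure `D_y`): the turn of the label `x`. -/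
  | probe (y x : ℕ × ℕ)
  /-- Transmission of the message (Procedure `T²`): the given turn of the given block. -/
  | relay (block turn : ℕ)

/-- The `i`-th (block, home) label in the order of two nested loops over blocks and homes. -/
def nthLabel (s γ : ℝ) (i : ℕ) : ℕ × ℕ := (i / numHomes s γ, i % numHomes s γ)

/-- Number of (block, home) labels. -/
def numLabels (s γ : ℝ) : ℕ := numBlocks s γ * numHomes s γ

/-- Number of rounds of the neighbourhood discovery `D*`: one execution of `D` and one of
`D_y` for every label `y`. -/
def discoveryTime (s γ : ℝ) : ℕ := numLabels s γ + numLabels s γ * numLabels s γ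

/-- Number of rounds that a block gets in an iteration of `T²`. -/
def numTurns (s γ : ℝ) : ℕ := (turns (homeRows s γ)).length

/-- Number of rounds of an iteration of the loop of `T²`. -/
def iterationTime (s γ : ℝ) : ℕ := numBlocks s γ * numTurns s γ

/-- The schedule of Algorithm `B²`: first `D*`, then the iterations of `T²`. -/
def task (s γ : ℝ) (t : ℕ) : Task :=
  if t < numLabels s γ then
    .hello (nthLabel s γ t)
  else if t < discoveryTime s γ then
    .probe (nthLabel s γ ((t - numLabels s γ) / numLabels s γ))
      (nthLabel s γ ((t - numLabels s γ) % numLabels s γ))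
  else
    .relay ((t - discoveryTime s γ) / numTurns s γ % numBlocks s γ)
      ((t - discoveryTime s γ) % numTurns s γ)

/-- Transmitted packets: a `hello`, or the message. -/
inductive Packet (M : Type*) where
  | hello
  | message (m : M)

/-- The local state of a node `u`. -/
structure NodeState (M : Type*) where
  /-- the set `N_u` of the labels of nodes known to `u` -/
  known : Set (ℕ × ℕ)
  /-- the source message, if `u` possesses it -/
  msg : Option M
  /-- the nodes of the own block that possessed the message when the spokesman status was last
  updated -/
  holders : Set Plane
  /-- whether `u` has sent the message -/
  sent : Bool

open Classical in
/-- The packet that a node at `p` with state `a` transmits for a given task. -/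
def sendTask {M : Type*} (s γ : ℝ) (p : Plane) (a : NodeState M) : Task → Option (Packet M)
  | .hello x => if label s γ p = x then some .hello else none
  | .probe y x => if label s γ p = x ∨ label s γ p = y then some .hello else none
  | .relay block turn =>
      if blockLabel s γ p = block ∧ a.sent = false ∧
          ∃ r, (turns (homeRows s γ))[turn]? = some r ∧ IsSpokesman s γ a.holders p r then
        a.msg.map .message
      else none

/-- The spokesman status is updated, from the information which nodes of the own block possess the
message, at the beginning of the turns of each block. -/
def updateTask {M : Type*} (info : Set Plane) (a : NodeState M) : Task → NodeState M
  | .relay _ 0 => { a with holders := info }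
  | _ => a

open Classical in
/-- The new state of a node at `p` with state `a` that has heard `h` during the given task. -/
def listenTask {M : Type*} (s γ : ℝ) (p : Plane) (a : NodeState M) (h : Option (Packet M)) :
    Task → NodeState M
  | .hello x =>
      if label s γ p ≠ x ∧ h = some .hello then { a with known := insert x a.known } else a
  | .probe y x =>
      if ¬ (label s γ p = x ∨ label s γ p = y) ∧ h ≠ some .hello ∧ y ∈ a.known then
        { a with known := insert x a.known }
      else a
  | .relay block turn =>
      { a with
        msg := match h with
          | some (.message m) => some m
          | _ => a.msg
        sent := a.sent || (sendTask s γ p a (.relay block turn)).isSome }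

/-- Algorithm `B²`, with the knowledge of the nodes of the own block that possess the message
as side information. -/
def algorithmB2 (M : Type*) (s γ : ℝ) :
    LocalAlgorithm M (Set Plane) (NodeState M) (Packet M) where
  init _ m := { known := ∅, msg := m, holders := ∅, sent := false }
  update t _ info a := updateTask info a (task s γ t)
  send t p a := sendTask s γ p a (task s γ t)
  listen t p a h := listenTask s γ p a h (task s γ t)

/-- The side information: the nodes of the block of `u` that currently possess the message. -/
def blockHolders {M : Type*} (s γ : ℝ) {V : Finset Plane} (st : V → NodeState M) (u : V) :
    Set Plane :=
  {p | ∃ w : V, (w : Plane) = p ∧ SameBlock s γ w u ∧ (st w).msg ≠ none}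

section

variable {M : Type*} (s γ : ℝ) {V : Finset Plane} (src : V) (m : M)

/-- The states of the nodes after `t` rounds of Algorithm `B²`. -/
def statesB2 (t : ℕ) : V → NodeState M :=
  states (algorithmB2 M s γ) s (blockHolders s γ) src m t

/-- Node `u` transmits in round `t` of Algorithm `B²`. -/
def TransmitsB2 (t : ℕ) (u : V) : Prop :=
  transmissions (algorithmB2 M s γ) (blockHolders s γ) t (statesB2 s γ src m t) u ≠ none

/-- No node transmits in iteration `j` of the loop of `T²`. -/
def SilentIteration (j : ℕ) : Prop :=
  ∀ i < iterationTime s γ, ∀ u : V,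
    ¬ TransmitsB2 s γ src m (discoveryTime s γ + j * iterationTime s γ + i) u

/-- Algorithm `B²` ends after exactly `T` rounds: the loop of `T²` is repeated until no node has
transmitted in an iteration. -/
def EndsAt (T : ℕ) : Prop :=
  ∃ j, SilentIteration s γ src m j ∧ (∀ i < j, ¬ SilentIteration s γ src m i) ∧
    T = discoveryTime s γ + (j + 1) * iterationTime s γ

end

end Swamping

end

noncomputable section

namespace Swamping

/-! ### Geometry of the partition -/

/-! Relaying succeeds because its senders never interfere. Blocks with equal labels in different
regions are more than 2 apart, and a home holds at most one node, so a block has one spokesman per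
role. Two simultaneous senders within distance 1 of a common node would be within 2 of each other,
hence equal. So every relay transmission reaches all neighbours of its sender (`relay_unique`,
`has_of_relay`).

The geometric core is `InBlock.exists_spokesman_near`: if `u` possesses the message and `v` is its
neighbour, then some spokesman of the block of `u` is a neighbour of `v`. If the block is a single
home, `u` is the spokesman. Otherwise the block diameter is at most a third of the width of the
annulus `(s, 1]`: when `v` is far from `u`, take a spokesman roughly towards `v`; when it is close,
one roughly away from `v`. The eight line ends seen from `u` supply every direction (`Towards`).

A spokesman that stays quiet has sent before and thereby served its neighbours, so each iteration
advances the message by one hop (`has_of_adj`). After `D` iterations everyone possesses it; one more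
iteration lets all remaining spokesmen send, and the next is silent. Conversely, a silent iteration
changes nothing, so its holder set is closed under adjacency and, by connectivity, is everything. An
iteration costs `O(1/l²) · O(l/γ) = O(g/l)` rounds and discovery `O((g²)²)`. Discovery matters only
through its length. -/

theorem dist_sq_eq (p q : Plane) :
    dist p q ^ 2 = (east p - east q) ^ 2 + (south p - south q) ^ 2 := by
  rw [EuclideanSpace.dist_eq, Real.sq_sqrt (by positivity), Fin.sum_univ_two]
  simp only [Real.dist_eq, sq_abs, east, south]
  ring

/-- Side length of a home. -/
abbrev homeLen (γ : ℝ) : ℝ := γ / √2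

theorem homeLen_pos {γ : ℝ} (hγ : 0 < γ) : 0 < homeLen γ := by positivity

theorem homeLen_sq (γ : ℝ) : 2 * homeLen γ ^ 2 = γ ^ 2 := by
  rw [homeLen, div_pow, Real.sq_sqrt (by norm_num)]; ring

theorem homeLen_le_blockLen (s γ : ℝ) : homeLen γ ≤ blockLen s γ := le_max_right _ _

theorem blockLen_pos (s : ℝ) {γ : ℝ} (hγ : 0 < γ) : 0 < blockLen s γ :=
  (homeLen_pos hγ).trans_le (homeLen_le_blockLen s γ)

theorem blockLen_lt_one {s γ : ℝ} (hs : 0 ≤ s) (hγ1 : γ ≤ 1) : blockLen s γ < 1 := by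
  have h2 : (1 : ℝ) < √2 := by rw [Real.lt_sqrt] <;> norm_num
  refine max_lt ?_ ?_ <;> rw [div_lt_one (by positivity)] <;> nlinarith

theorem regionOff_nonneg (z : ℝ) : 0 ≤ regionOff z := by
  have := Int.floor_le (z / 3)
  unfold regionOff regionIdx; linarith

theorem regionOff_lt (z : ℝ) : regionOff z < 3 := by
  have := Int.lt_floor_add_one (z / 3)
  unfold regionOff regionIdx; linarith

theorem blockOff_nonneg (s z : ℝ) {γ : ℝ} (hγ : 0 < γ) : 0 ≤ blockOff s γ z := by
  have hl := blockLen_pos s hγ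
  have := Nat.floor_le (div_nonneg (regionOff_nonneg z) hl.le)
  rw [le_div_iff₀ hl] at this
  unfold blockOff blockIdx; linarith

theorem blockOff_lt (s z : ℝ) {γ : ℝ} (hγ : 0 < γ) : blockOff s γ z < blockLen s γ := by
  have hl := blockLen_pos s hγ
  have := Nat.lt_floor_add_one (regionOff z / blockLen s γ)
  rw [div_lt_iff₀ hl] at this
  unfold blockOff blockIdx; linarith

theorem homeIdx_le (s z : ℝ) {γ : ℝ} (hγ : 0 < γ) :
    homeIdx s γ z * homeLen γ ≤ blockOff s γ z := by
  have hl := homeLen_pos hγ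
  have := Nat.floor_le (div_nonneg (blockOff_nonneg s z hγ) hl.le)
  rwa [le_div_iff₀ hl] at this

theorem lt_homeIdx_add_one (s z : ℝ) {γ : ℝ} (hγ : 0 < γ) :
    blockOff s γ z < (homeIdx s γ z + 1) * homeLen γ := by
  have hl := homeLen_pos hγ
  have := Nat.lt_floor_add_one (blockOff s γ z / homeLen γ)
  rwa [div_lt_iff₀ hl] at this

theorem blockIdx_lt (s z : ℝ) {γ : ℝ} (hγ : 0 < γ) : blockIdx s γ z < blockRows s γ := by
  have hl := blockLen_pos s hγ
  refine (Nat.floor_lt (div_nonneg (regionOff_nonneg z) hl.le)).2 (lt_of_lt_of_le ?_ (Nat.le_ceil _))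
  have := regionOff_lt z
  gcongr

theorem homeIdx_lt (s z : ℝ) {γ : ℝ} (hγ : 0 < γ) : homeIdx s γ z < homeRows s γ := by
  have hl := homeLen_pos hγ
  refine (Nat.floor_lt (div_nonneg (blockOff_nonneg s z hγ) hl.le)).2
    (lt_of_lt_of_le ?_ (Nat.le_ceil _))
  rw [div_lt_iff₀ hl]
  have h2 : √2 * blockLen s γ / γ * (γ / √2) = blockLen s γ := by field_simp
  rw [h2]
  exact blockOff_lt s z hγ

theorem homeRows_pos (s : ℝ) {γ : ℝ} (hγ : 0 < γ) : 0 < homeRows s γ :=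
  (Nat.zero_le _).trans_lt (homeIdx_lt s 0 hγ)

theorem blockLabel_lt (s : ℝ) {γ : ℝ} (hγ : 0 < γ) (p : Plane) :
    blockLabel s γ p < numBlocks s γ := by
  have h1 := blockIdx_lt s (south p) hγ
  have h2 := blockIdx_lt s (east p) hγ
  unfold blockLabel numBlocks
  nlinarith

theorem blockLabel_inj {s γ : ℝ} (hγ : 0 < γ) {p q : Plane}
    (h : blockLabel s γ p = blockLabel s γ q) :
    blockIdx s γ (east p) = blockIdx s γ (east q) ∧
      blockIdx s γ (south p) = blockIdx s γ (south q) := by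
  have hp := blockIdx_lt s (east p) hγ
  have hq := blockIdx_lt s (east q) hγ
  have key (r : Plane) (hr : blockIdx s γ (east r) < blockRows s γ) :
      blockLabel s γ r % blockRows s γ = blockIdx s γ (east r) := by
    rw [blockLabel, Nat.mul_add_mod_self_right, Nat.mod_eq_of_lt hr]
  have h1 : blockIdx s γ (east p) = blockIdx s γ (east q) := by
    rw [← key p hp, ← key q hq, h]
  refine ⟨h1, ?_⟩
  unfold blockLabel at h
  rw [h1, Nat.add_right_cancel_iff] at h
  exact Nat.eq_of_mul_eq_mul_right (by omega) h

theorem SameBlock.refl (s γ : ℝ) (p : Plane) : SameBlock s γ p p := ⟨rfl, rfl, rfl, rfl⟩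

theorem SameBlock.symm {s γ : ℝ} {p q : Plane} (h : SameBlock s γ p q) : SameBlock s γ q p :=
  ⟨h.1.symm, h.2.1.symm, h.2.2.1.symm, h.2.2.2.symm⟩

theorem SameBlock.trans {s γ : ℝ} {p q r : Plane} (h : SameBlock s γ p q)
    (h' : SameBlock s γ q r) : SameBlock s γ p r :=
  ⟨h.1.trans h'.1, h.2.1.trans h'.2.1, h.2.2.1.trans h'.2.2.1, h.2.2.2.trans h'.2.2.2⟩

/-- Difference of two coordinates in the same block interval. -/
theorem sub_eq_blockOff_sub {s γ z z' : ℝ} (hr : regionIdx z = regionIdx z')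
    (hb : blockIdx s γ z = blockIdx s γ z') : z - z' = blockOff s γ z - blockOff s γ z' := by
  simp only [blockOff, regionOff, hr, hb]; ring

theorem abs_sub_lt_blockLen {s γ z z' : ℝ} (hγ : 0 < γ) (hr : regionIdx z = regionIdx z')
    (hb : blockIdx s γ z = blockIdx s γ z') : |z - z'| < blockLen s γ := by
  rw [sub_eq_blockOff_sub hr hb, abs_lt]
  have := blockOff_nonneg s z hγ
  have := blockOff_nonneg s z' hγ
  have := blockOff_lt s z hγ
  have := blockOff_lt s z' hγ
  constructor <;> linarith

theorem abs_sub_lt_homeLen {s γ z z' : ℝ} (hγ : 0 < γ) (hr : regionIdx z = regionIdx z')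
    (hb : blockIdx s γ z = blockIdx s γ z') (hh : homeIdx s γ z = homeIdx s γ z') :
    |z - z'| < homeLen γ := by
  rw [sub_eq_blockOff_sub hr hb, abs_lt]
  have h1 := homeIdx_le s z hγ
  have h2 := homeIdx_le s z' hγ
  have h3 := lt_homeIdx_add_one s z hγ
  have h4 := lt_homeIdx_add_one s z' hγ
  rw [hh] at h1 h3
  constructor <;> linarith

theorem lt_of_homeIdx_lt {s γ z z' : ℝ} (hγ : 0 < γ) (hr : regionIdx z = regionIdx z')
    (hb : blockIdx s γ z = blockIdx s γ z') (hh : homeIdx s γ z < homeIdx s γ z') : z < z' := by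
  have h0 := sub_eq_blockOff_sub hr hb
  have h2 := homeIdx_le s z' hγ
  have h3 := lt_homeIdx_add_one s z hγ
  have h5 : ((homeIdx s γ z + 1 : ℕ) : ℝ) ≤ homeIdx s γ z' := by exact_mod_cast hh
  push_cast at h5
  have := mul_le_mul_of_nonneg_right h5 (homeLen_pos hγ).le
  linarith

/-- The coordinates differ by a nonzero multiple of 3, up to a difference of block offsets of
absolute value below `l < 1`. -/
theorem two_lt_abs_sub {s γ z z' : ℝ} (hs : 0 ≤ s) (hγ : 0 < γ) (hγ1 : γ ≤ 1)
    (hr : regionIdx z ≠ regionIdx z') (hb : blockIdx s γ z = blockIdx s γ z') :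
    2 < |z - z'| := by
  have e : z - z' = 3 * ((regionIdx z - regionIdx z' : ℤ) : ℝ)
      + (blockOff s γ z - blockOff s γ z') := by
    simp only [blockOff, regionOff, hb]; push_cast; ring
  have := blockOff_nonneg s z hγ
  have := blockOff_nonneg s z' hγ
  have := blockOff_lt s z hγ
  have := blockOff_lt s z' hγ
  have := blockLen_lt_one hs hγ1
  rw [lt_abs, e]
  rcases lt_or_gt_of_ne (sub_ne_zero.2 hr) with h | h
  · right
    have : ((regionIdx z - regionIdx z' : ℤ) : ℝ) ≤ -1 := by exact_mod_cast (by omega)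
    linarith
  · left
    have : (1 : ℝ) ≤ ((regionIdx z - regionIdx z' : ℤ) : ℝ) := by exact_mod_cast h
    linarith

/-- Blocks with the same label in different regions are more than `2` apart. -/
theorem sameBlock_of_dist_le_two {s γ : ℝ} (hs : 0 ≤ s) (hγ : 0 < γ) (hγ1 : γ ≤ 1) {p q : Plane}
    (h : blockLabel s γ p = blockLabel s γ q) (hd : dist p q ≤ 2) : SameBlock s γ p q := by
  obtain ⟨he, hso⟩ := blockLabel_inj hγ h
  have hd2 := dist_sq_eq p q
  have hd4 : dist p q ^ 2 ≤ 4 := by nlinarith [dist_nonneg (x := p) (y := q)]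
  refine ⟨?_, ?_, he, hso⟩ <;> by_contra hne
  · have := two_lt_abs_sub hs hγ hγ1 hne he
    nlinarith [sq_abs (east p - east q), sq_nonneg (south p - south q)]
  · have := two_lt_abs_sub hs hγ hγ1 hne hso
    nlinarith [sq_abs (south p - south q), sq_nonneg (east p - east q)]

/-- The nodes of `K` lie in the block of `u` and have pairwise distances at least `γ`. -/
structure InBlock (s γ : ℝ) (K : Set Plane) (u : Plane) : Prop where
  sameBlock : ∀ p ∈ K, SameBlock s γ p u
  sep : ∀ p ∈ K, ∀ q ∈ K, p ≠ q → γ ≤ dist p q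

/-! ### Spokesmen: order along lines, directions, and neighbours -/

section Spokesmen

variable {s γ : ℝ} {K : Set Plane} {u v p q : Plane}

theorem InBlock.abs_south_sub_lt (h : InBlock s γ K u) (hγ : 0 < γ) (hp : p ∈ K) (hq : q ∈ K)
    (hr : homeRow s γ p = homeRow s γ q) : |south p - south q| < homeLen γ :=
  have hb := (h.sameBlock p hp).trans (h.sameBlock q hq).symm
  abs_sub_lt_homeLen hγ hb.2.1 hb.2.2.2 hr

theorem InBlock.abs_east_sub_lt (h : InBlock s γ K u) (hγ : 0 < γ) (hp : p ∈ K) (hq : q ∈ K)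
    (hr : homeCol s γ p = homeCol s γ q) : |east p - east q| < homeLen γ :=
  have hb := (h.sameBlock p hp).trans (h.sameBlock q hq).symm
  abs_sub_lt_homeLen hγ hb.1 hb.2.2.1 hr

theorem InBlock.south_lt (h : InBlock s γ K u) (hγ : 0 < γ) (hp : p ∈ K) (hq : q ∈ K)
    (hr : homeRow s γ p < homeRow s γ q) : south p < south q :=
  have hb := (h.sameBlock p hp).trans (h.sameBlock q hq).symm
  lt_of_homeIdx_lt hγ hb.2.1 hb.2.2.2 hr

theorem InBlock.east_lt (h : InBlock s γ K u) (hγ : 0 < γ) (hp : p ∈ K) (hq : q ∈ K)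
    (hr : homeCol s γ p < homeCol s γ q) : east p < east q :=
  have hb := (h.sameBlock p hp).trans (h.sameBlock q hq).symm
  lt_of_homeIdx_lt hγ hb.1 hb.2.2.1 hr

theorem InBlock.le_sq (h : InBlock s γ K u) (hγ : 0 < γ) (hp : p ∈ K) (hq : q ∈ K) (hne : p ≠ q) :
    2 * homeLen γ ^ 2 ≤ (east p - east q) ^ 2 + (south p - south q) ^ 2 := by
  rw [← dist_sq_eq, homeLen_sq]
  have := h.sep p hp q hq hne
  gcongr

/-- A home contains at most one node. -/
theorem InBlock.eq_of_home_eq (h : InBlock s γ K u) (hγ : 0 < γ) (hp : p ∈ K) (hq : q ∈ K)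
    (hr : homeRow s γ p = homeRow s γ q) (hc : homeCol s γ p = homeCol s γ q) : p = q := by
  by_contra hne
  have h1 := h.le_sq hγ hp hq hne
  have h2 := sq_lt_sq' (neg_lt_of_abs_lt (h.abs_south_sub_lt hγ hp hq hr))
    (lt_of_abs_lt (h.abs_south_sub_lt hγ hp hq hr))
  have h3 := sq_lt_sq' (neg_lt_of_abs_lt (h.abs_east_sub_lt hγ hp hq hc))
    (lt_of_abs_lt (h.abs_east_sub_lt hγ hp hq hc))
  linarith

theorem homeRow_lt (s : ℝ) {γ : ℝ} (hγ : 0 < γ) (p : Plane) : homeRow s γ p < homeRows s γ :=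
  homeIdx_lt s _ hγ

theorem homeCol_lt (s : ℝ) {γ : ℝ} (hγ : 0 < γ) (p : Plane) : homeCol s γ p < homeRows s γ :=
  homeIdx_lt s _ hγ

/-- For each role a block has at most one spokesman. -/
theorem IsSpokesman.unique (h : InBlock s γ K u) (hγ : 0 < γ) {r : Role}
    (hp : IsSpokesman s γ K p r) (hq : IsSpokesman s γ K q r) : p = q := by
  have := homeRow_lt s hγ p
  have := homeRow_lt s hγ q
  -- Both nodes lie on the same line and are extremal on it, so their homes coincide.
  cases r <;> obtain ⟨hpK, hpi, hp⟩ := hp <;> obtain ⟨hqK, hqi, hq⟩ := hq <;>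
    have h1 := hp q hqK hqi <;> have h2 := hq p hpK hpi <;>
    (try simp only [antiDiag, mainDiag] at hpi hqi) <;>
    exact h.eq_of_home_eq hγ hpK hqK (by omega) (by omega)

theorem IsSpokesman.mem {r : Role} (hp : IsSpokesman s γ K p r) : p ∈ K := by
  cases r <;> exact hp.1

/-- The displacement `(a, b)` points roughly in the direction `(x, y)`. -/
def Towards (a b x y : ℝ) : Prop :=
  (|b| ≤ |a| ∧ 0 ≤ a * x ∧ 2 * |y| ≤ |x|) ∨ (|a| ≤ |b| ∧ 0 ≤ b * y ∧ 2 * |x| ≤ |y|) ∨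
    (0 ≤ a * x ∧ 0 ≤ b * y ∧ |x| ≤ 2 * |y| ∧ |y| ≤ 2 * |x|)

theorem Towards.inner_nonneg {a b x y : ℝ} (h : Towards a b x y) : 0 ≤ a * x + b * y := by
  have hax : |a * x| = |a| * |x| := abs_mul a x
  have hby : |b * y| = |b| * |y| := abs_mul b y
  rcases h with ⟨h1, h2, h3⟩ | ⟨h1, h2, h3⟩ | ⟨h1, h2, -, -⟩
  · have : |b| * |y| ≤ |a| * |x| :=
      mul_le_mul h1 (by linarith [abs_nonneg y]) (abs_nonneg y) (abs_nonneg a)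
    rw [abs_of_nonneg h2] at hax
    linarith [neg_abs_le (b * y)]
  · have : |a| * |x| ≤ |b| * |y| :=
      mul_le_mul h1 (by linarith [abs_nonneg x]) (abs_nonneg x) (abs_nonneg b)
    rw [abs_of_nonneg h2] at hby
    linarith [neg_abs_le (a * x)]
  · linarith

/-- For `d = (a, b)` and `z = (x, y)`, the conclusion says `|z - d| ≤ |z|`: moving by `d` does not
increase the distance to the target. This needs the angle bounded away from 90° and `d` short
compared with `z`; the bounds are `l ≤ 1/4` and `|z| ≥ 2/3`. -/
theorem Towards.sq_le {a b x y : ℝ} (h : Towards a b x y) (ha : |a| ≤ 1 / 4) (hb : |b| ≤ 1 / 4)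
    (hxy : 4 / 9 ≤ x ^ 2 + y ^ 2) : a ^ 2 + b ^ 2 ≤ 2 * (a * x + b * y) := by
  have hax : |a * x| = |a| * |x| := abs_mul a x
  have hby : |b * y| = |b| * |y| := abs_mul b y
  have ha0 := abs_nonneg a
  have hb0 := abs_nonneg b
  have hx0 := abs_nonneg x
  have hy0 := abs_nonneg y
  rw [← sq_abs x, ← sq_abs y] at hxy
  rw [← sq_abs a, ← sq_abs b]
  rcases h with ⟨h1, h2, h3⟩ | ⟨h1, h2, h3⟩ | ⟨h1, h2, h3, h4⟩
  · rw [abs_of_nonneg h2] at hax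
    have hb' := neg_abs_le (b * y)
    -- Here `x² + y² ≤ 5x²/4`, so `x² ≥ 16/45 > 1/4`.
    have hx : 1 / 2 ≤ |x| := by nlinarith
    have e1 : |b| * |y| ≤ |a| * (|x| / 2) := by gcongr; linarith
    have e2 : |b| ^ 2 ≤ |a| ^ 2 := by gcongr
    have e3 : |a| * |a| ≤ |a| * (|x| / 2) := by gcongr; linarith
    nlinarith
  · rw [abs_of_nonneg h2] at hby
    have hb' := neg_abs_le (a * x)
    have hx : 1 / 2 ≤ |y| := by nlinarith
    have e1 : |a| * |x| ≤ |b| * (|y| / 2) := by gcongr; linarith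
    have e2 : |a| ^ 2 ≤ |b| ^ 2 := by gcongr
    have e3 : |b| * |b| ≤ |b| * (|y| / 2) := by gcongr; linarith
    nlinarith
  · rw [abs_of_nonneg h1] at hax
    rw [abs_of_nonneg h2] at hby
    -- Here `x² + y² ≤ 5x²`, so `x² ≥ 4/45 > 1/16`.
    have hx : 1 / 4 ≤ |x| := by nlinarith
    have hy : 1 / 4 ≤ |y| := by nlinarith
    have e1 : |a| * |a| ≤ |a| * |x| := mul_le_mul_of_nonneg_left (by linarith) ha0
    have e2 : |b| * |b| ≤ |b| * |y| := mul_le_mul_of_nonneg_left (by linarith) hb0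
    nlinarith

/-- A row is lower than `homeLen γ`, while distinct nodes are at least `√2 * homeLen γ` apart; hence
the horizontal difference dominates and the displacement is within 45° of the row. -/
theorem InBlock.abs_south_sub_le_of_row (h : InBlock s γ K u) (hγ : 0 < γ) (hp : p ∈ K)
    (hq : q ∈ K) (hr : homeRow s γ p = homeRow s γ q) :
    |south p - south q| ≤ |east p - east q| := by
  rcases eq_or_ne p q with rfl | hne
  · simp
  have h1 := h.abs_south_sub_lt hγ hp hq hr
  have h2 := h.le_sq hγ hp hq hne
  have h3 : |south p - south q| ^ 2 ≤ homeLen γ ^ 2 := pow_le_pow_left₀ (abs_nonneg _) h1.le 2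
  rw [sq_abs] at h3
  exact sq_le_sq.1 (by linarith)

theorem InBlock.abs_east_sub_le_of_col (h : InBlock s γ K u) (hγ : 0 < γ) (hp : p ∈ K)
    (hq : q ∈ K) (hr : homeCol s γ p = homeCol s γ q) :
    |east p - east q| ≤ |south p - south q| := by
  rcases eq_or_ne p q with rfl | hne
  · simp
  have h1 := h.abs_east_sub_lt hγ hp hq hr
  have h2 := h.le_sq hγ hp hq hne
  have h3 : |east p - east q| ^ 2 ≤ homeLen γ ^ 2 := pow_le_pow_left₀ (abs_nonneg _) h1.le 2
  rw [sq_abs] at h3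
  exact sq_le_sq.1 (by linarith)

theorem InBlock.east_le_of_row (h : InBlock s γ K u) (hγ : 0 < γ) (hp : p ∈ K)
    (hq : q ∈ K) (hr : homeRow s γ p = homeRow s γ q) (hc : homeCol s γ p ≤ homeCol s γ q) :
    east p ≤ east q := by
  rcases hc.eq_or_lt with hc | hc
  · rw [h.eq_of_home_eq hγ hp hq hr hc]
  · exact (h.east_lt hγ hp hq hc).le

theorem InBlock.south_le_of_col (h : InBlock s γ K u) (hγ : 0 < γ) (hp : p ∈ K)
    (hq : q ∈ K) (hc : homeCol s γ p = homeCol s γ q) (hr : homeRow s γ p ≤ homeRow s γ q) :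
    south p ≤ south q := by
  rcases hr.eq_or_lt with hr | hr
  · rw [h.eq_of_home_eq hγ hp hq hr hc]
  · exact (h.south_lt hγ hp hq hr).le

/-- Along this diagonal columns grow as rows shrink, so displacements stay in one closed quadrant.
-/
theorem InBlock.le_of_antiDiag (h : InBlock s γ K u) (hγ : 0 < γ) (hp : p ∈ K)
    (hq : q ∈ K) (hd : antiDiag s γ p = antiDiag s γ q) (hc : homeCol s γ p ≤ homeCol s γ q) :
    east p ≤ east q ∧ south q ≤ south p := by
  unfold antiDiag at hd
  rcases hc.eq_or_lt with hc | hc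
  · rw [h.eq_of_home_eq hγ hp hq (by omega) hc]; simp
  · exact ⟨(h.east_lt hγ hp hq hc).le, (h.south_lt hγ hq hp (by omega)).le⟩

theorem InBlock.le_of_mainDiag (h : InBlock s γ K u) (hγ : 0 < γ) (hp : p ∈ K)
    (hq : q ∈ K) (hd : mainDiag s γ p = mainDiag s γ q) (hc : homeCol s γ p ≤ homeCol s γ q) :
    east p ≤ east q ∧ south p ≤ south q := by
  -- The row bounds keep the subtraction in `mainDiag` from truncating.
  have := homeRow_lt s hγ p
  have := homeRow_lt s hγ q
  unfold mainDiag at hd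
  rcases hc.eq_or_lt with hc | hc
  · rw [h.eq_of_home_eq hγ hp hq (by omega) hc]; simp
  · exact ⟨(h.east_lt hγ hp hq hc).le, (h.south_lt hγ hp hq (by omega)).le⟩

/-- `f` selects the line through `u`, and `g` is the position along it. -/
theorem exists_line_max (hK : K.Finite) (hu : u ∈ K) (f g : Plane → ℕ) :
    ∃ w ∈ K, f w = f u ∧ ∀ q ∈ K, f q = f u → g q ≤ g w := by
  obtain ⟨w, hw, hmax⟩ := Set.exists_max_image {q ∈ K | f q = f u} g
    (hK.subset (Set.sep_subset _ _)) ⟨u, hu, rfl⟩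
  exact ⟨w, hw.1, hw.2, fun q hq hf => hmax q ⟨hq, hf⟩⟩

theorem exists_line_min (hK : K.Finite) (hu : u ∈ K) (f g : Plane → ℕ) :
    ∃ w ∈ K, f w = f u ∧ ∀ q ∈ K, f q = f u → g w ≤ g q := by
  obtain ⟨w, hw, hmin⟩ := Set.exists_min_image {q ∈ K | f q = f u} g
    (hK.subset (Set.sep_subset _ _)) ⟨u, hu, rfl⟩
  exact ⟨w, hw.1, hw.2, fun q hq hf => hmin q ⟨hq, hf⟩⟩

/-- In every direction some spokesman is seen from `u`. -/
theorem InBlock.exists_spokesman_towards (h : InBlock s γ K u) (hγ : 0 < γ) (hK : K.Finite)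
    (hu : u ∈ K) (x y : ℝ) :
    ∃ w, ∃ r ∈ turns (homeRows s γ), IsSpokesman s γ K w r ∧
      Towards (east w - east u) (south w - south u) x y := by
  have hrow := homeRow_lt s hγ u
  have hcol := homeCol_lt s hγ u
  have hanti : antiDiag s γ u < 2 * homeRows s γ - 1 := by unfold antiDiag; omega
  have hmain : mainDiag s γ u < 2 * homeRows s γ - 1 := by unfold mainDiag; omega
  -- Sectors are cut at slopes 1/2 and 2: flat directions use the row of `u`, steep ones its column,
  -- the others a diagonal.
  by_cases h1 : 2 * |y| ≤ |x|
  · rcases le_total 0 x with hx | hx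
    · obtain ⟨w, hw, hwu, hm⟩ := exists_line_max hK hu (homeRow s γ) (homeCol s γ)
      have := h.east_le_of_row hγ hu hw hwu.symm (hm u hu rfl)
      exact ⟨w, .E (homeRow s γ u), by simp [turns, hrow], ⟨hw, hwu, hm⟩,
        .inl ⟨h.abs_south_sub_le_of_row hγ hw hu hwu,
          mul_nonneg (sub_nonneg.2 this) hx, h1⟩⟩
    · obtain ⟨w, hw, hwu, hm⟩ := exists_line_min hK hu (homeRow s γ) (homeCol s γ)
      have := h.east_le_of_row hγ hw hu hwu (hm u hu rfl)
      exact ⟨w, .W (homeRow s γ u), by simp [turns, hrow], ⟨hw, hwu, hm⟩,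
        .inl ⟨h.abs_south_sub_le_of_row hγ hw hu hwu,
          mul_nonneg_of_nonpos_of_nonpos (sub_nonpos.2 this) hx, h1⟩⟩
  by_cases h2 : 2 * |x| ≤ |y|
  · rcases le_total 0 y with hy | hy
    · obtain ⟨w, hw, hwu, hm⟩ := exists_line_max hK hu (homeCol s γ) (homeRow s γ)
      have := h.south_le_of_col hγ hu hw hwu.symm (hm u hu rfl)
      exact ⟨w, .S (homeCol s γ u), by simp [turns, hcol], ⟨hw, hwu, hm⟩,
        .inr (.inl ⟨h.abs_east_sub_le_of_col hγ hw hu hwu,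
          mul_nonneg (sub_nonneg.2 this) hy, h2⟩)⟩
    · obtain ⟨w, hw, hwu, hm⟩ := exists_line_min hK hu (homeCol s γ) (homeRow s γ)
      have := h.south_le_of_col hγ hw hu hwu (hm u hu rfl)
      exact ⟨w, .N (homeCol s γ u), by simp [turns, hcol], ⟨hw, hwu, hm⟩,
        .inr (.inl ⟨h.abs_east_sub_le_of_col hγ hw hu hwu,
          mul_nonneg_of_nonpos_of_nonpos (sub_nonpos.2 this) hy, h2⟩)⟩
  have h1' : |x| ≤ 2 * |y| := by linarith
  have h2' : |y| ≤ 2 * |x| := by linarith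
  rcases le_total 0 x with hx | hx <;> rcases le_total 0 y with hy | hy
  · obtain ⟨w, hw, hwu, hm⟩ := exists_line_max hK hu (mainDiag s γ) (homeCol s γ)
    have := h.le_of_mainDiag hγ hu hw hwu.symm (hm u hu rfl)
    exact ⟨w, .SE (mainDiag s γ u), by simp [turns, hmain], ⟨hw, hwu, hm⟩,
      .inr (.inr ⟨mul_nonneg (sub_nonneg.2 this.1) hx,
        mul_nonneg (sub_nonneg.2 this.2) hy, h1', h2'⟩)⟩
  · obtain ⟨w, hw, hwu, hm⟩ := exists_line_max hK hu (antiDiag s γ) (homeCol s γ)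
    have := h.le_of_antiDiag hγ hu hw hwu.symm (hm u hu rfl)
    exact ⟨w, .NE (antiDiag s γ u), by simp [turns, hanti], ⟨hw, hwu, hm⟩,
      .inr (.inr ⟨mul_nonneg (sub_nonneg.2 this.1) hx,
        mul_nonneg_of_nonpos_of_nonpos (sub_nonpos.2 this.2) hy, h1', h2'⟩)⟩
  · obtain ⟨w, hw, hwu, hm⟩ := exists_line_min hK hu (antiDiag s γ) (homeCol s γ)
    have := h.le_of_antiDiag hγ hw hu hwu (hm u hu rfl)
    exact ⟨w, .SW (antiDiag s γ u), by simp [turns, hanti], ⟨hw, hwu, hm⟩,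
      .inr (.inr ⟨mul_nonneg_of_nonpos_of_nonpos (sub_nonpos.2 this.1) hx,
        mul_nonneg (sub_nonneg.2 this.2) hy, h1', h2'⟩)⟩
  · obtain ⟨w, hw, hwu, hm⟩ := exists_line_min hK hu (mainDiag s γ) (homeCol s γ)
    have := h.le_of_mainDiag hγ hw hu hwu (hm u hu rfl)
    exact ⟨w, .NW (mainDiag s γ u), by simp [turns, hmain], ⟨hw, hwu, hm⟩,
      .inr (.inr ⟨mul_nonneg_of_nonpos_of_nonpos (sub_nonpos.2 this.1) hx,
        mul_nonneg_of_nonpos_of_nonpos (sub_nonpos.2 this.2) hy, h1', h2'⟩)⟩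

theorem SameBlock.dist_lt (hγ : 0 < γ) (h : SameBlock s γ p q) : dist p q < √2 * blockLen s γ := by
  have hl := blockLen_pos s hγ
  have h1 := abs_sub_lt_blockLen hγ h.1 h.2.2.1
  have h2 := abs_sub_lt_blockLen hγ h.2.1 h.2.2.2
  have h1' := sq_lt_sq' (neg_lt_of_abs_lt h1) (lt_of_abs_lt h1)
  have h2' := sq_lt_sq' (neg_lt_of_abs_lt h2) (lt_of_abs_lt h2)
  refine lt_of_pow_lt_pow_left₀ 2 (by positivity) ?_
  rw [dist_sq_eq, mul_pow, Real.sq_sqrt (by norm_num)]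
  linarith

/-- A neighbour of a node of `K` is a neighbour of a spokesman. -/
theorem InBlock.exists_spokesman_near (h : InBlock s γ K u) (hγ : 0 < γ) (hs : 0 ≤ s)
    (hK : K.Finite) (hu : u ∈ K) (h1 : s < dist u v) (h2 : dist u v ≤ 1) :
    ∃ w, ∃ r ∈ turns (homeRows s γ), IsSpokesman s γ K w r ∧ s < dist w v ∧ dist w v ≤ 1 := by
  have h2pos : (0 : ℝ) < √2 := by positivity
  rcases le_or_gt ((1 - s) / (3 * √2)) (γ / √2) with hl | hl
  · have hbl : √2 * blockLen s γ = γ := by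
      rw [blockLen, max_eq_right hl]; field_simp
    -- The direction is irrelevant: the block has diameter less than `γ`, so `u` is its only holder.
    obtain ⟨w, r, hr, hw, -⟩ := h.exists_spokesman_towards hγ hK hu 0 0
    have hwu : w = u := by
      by_contra hne
      have := h.sep w hw.mem u hu hne
      have := (h.sameBlock w hw.mem).dist_lt hγ
      linarith
    exact ⟨w, r, hr, hw, hwu ▸ h1, hwu ▸ h2⟩
  have hbl : √2 * blockLen s γ = (1 - s) / 3 := by
    rw [blockLen, max_eq_left hl.le]; field_simp
  have hd0 : 0 ≤ dist u v := dist_nonneg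
  have hsq := dist_sq_eq u v
  have hquarter : blockLen s γ ≤ 1 / 4 := by
    have h43 : (4 / 3 : ℝ) ≤ √2 := by rw [Real.le_sqrt] <;> norm_num
    nlinarith [blockLen_pos s hγ]
  -- The threshold is `1 - (1 - s)/3 = s + 2(1 - s)/3`: a move of length below `(1 - s)/3` cannot
  -- leave the annulus inwards from beyond it, nor outwards from below it.
  by_cases hfar : 2 / 3 + s / 3 ≤ dist u v
  · obtain ⟨w, r, hr, hw, ht⟩ := h.exists_spokesman_towards hγ hK hu
      (east v - east u) (south v - south u)
    have hb := h.sameBlock w hw.mem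
    have hwu := hb.dist_lt hγ
    have := dist_triangle_left u v w
    have hsqw := dist_sq_eq w v
    have hle := ht.sq_le ((abs_sub_lt_blockLen hγ hb.1 hb.2.2.1).le.trans hquarter)
      ((abs_sub_lt_blockLen hγ hb.2.1 hb.2.2.2).le.trans hquarter) (by nlinarith)
    refine ⟨w, r, hr, hw, by linarith, ?_⟩
    have : dist w v ≤ dist u v := by
      refine (sq_le_sq₀ dist_nonneg hd0).1 ?_
      nlinarith
    linarith
  -- The direction now points from `v` to `u`, so a nonnegative inner product suffices for the
  -- distance not to shrink.
  · obtain ⟨w, r, hr, hw, ht⟩ := h.exists_spokesman_towards hγ hK hu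
      (east u - east v) (south u - south v)
    have hb := h.sameBlock w hw.mem
    have hwu := hb.dist_lt hγ
    have := dist_triangle w u v
    have hsqw := dist_sq_eq w v
    have hle := ht.inner_nonneg
    refine ⟨w, r, hr, hw, ?_, by linarith⟩
    have : dist u v ≤ dist w v := by
      refine (sq_le_sq₀ hd0 dist_nonneg).1 ?_
      nlinarith [sq_nonneg (east w - east u), sq_nonneg (south w - south u)]
    linarith

end Spokesmen

/-! ### Reception -/

theorem Receives.unique {P : Type*} {s : ℝ} {V : Finset Plane} {tx : V → Option P} {v : V}
    {p q : P} (hp : Receives s tx v p) (hq : Receives s tx v q) : p = q := by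
  obtain ⟨-, -, u, hu, hup, -⟩ := hp
  obtain ⟨-, -, w, -, hwq, hw⟩ := hq
  have := hw u hu (by simp [hup])
  subst this
  simpa [hup] using hwq

theorem heard_eq_some_iff {P : Type*} {s : ℝ} {V : Finset Plane} {tx : V → Option P} {v : V}
    {p : P} : heard s tx v = some p ↔ Receives s tx v p := by
  unfold heard
  split_ifs with h
  · rw [Option.some_inj]
    exact ⟨fun e => e ▸ h.choose_spec, fun e => h.choose_spec.unique e⟩
  · simpa using fun hp => h ⟨p, hp⟩

/-! ### Single rounds of the algorithm -/

section Tasks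

variable {M : Type*} {s γ : ℝ} {p : Plane} {a : NodeState M} {h : Option (Packet M)} {k : Task}

@[simp] theorem updateTask_msg (info : Set Plane) : (updateTask info a k).msg = a.msg := by
  unfold updateTask; split <;> rfl

@[simp] theorem updateTask_sent (info : Set Plane) : (updateTask info a k).sent = a.sent := by
  unfold updateTask; split <;> rfl

@[simp] theorem listenTask_holders : (listenTask s γ p a h k).holders = a.holders := by
  cases k <;> simp only [listenTask] <;> (try split_ifs) <;> rfl

theorem sendTask_relay {b r : ℕ} {x : Packet M} (hx : sendTask s γ p a (.relay b r) = some x) :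
    blockLabel s γ p = b ∧ a.sent = false ∧
      (∃ role, (turns (homeRows s γ))[r]? = some role ∧ IsSpokesman s γ a.holders p role) ∧
      ∃ m', a.msg = some m' ∧ x = .message m' := by
  simp only [sendTask] at hx
  split_ifs at hx with hc
  obtain ⟨m', hm, rfl⟩ := Option.map_eq_some_iff.1 hx
  exact ⟨hc.1, hc.2.1, hc.2.2, m', hm, rfl⟩

theorem listenTask_msg_of_heard {m : M} {b r : ℕ} :
    (listenTask s γ p a (some (.message m)) (.relay b r)).msg = some m := rfl

theorem listenTask_msg :
    (listenTask s γ p a h k).msg = a.msg ∨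
      (∃ b r, k = .relay b r) ∧ ∃ m', h = some (.message m') ∧
        (listenTask s γ p a h k).msg = some m' := by
  cases k with
  | hello x => left; simp only [listenTask]; split_ifs <;> rfl
  | probe y x => left; simp only [listenTask]; split_ifs <;> rfl
  | relay b r =>
    rcases h with _ | (_ | m')
    · exact .inl rfl
    · exact .inl rfl
    · exact .inr ⟨⟨b, r, rfl⟩, m', rfl, rfl⟩

theorem listenTask_sent :
    (listenTask s γ p a h k).sent = true ↔
      a.sent = true ∨ (∃ b r, k = .relay b r) ∧ sendTask s γ p a k ≠ none := by
  cases k with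
  | hello x => simp only [listenTask]; split_ifs <;> simp
  | probe y x => simp only [listenTask]; split_ifs <;> simp
  | relay b r => simp [listenTask, Option.isSome_iff_ne_none]

end Tasks

/-- The standing assumptions on the parameters and the nodes. -/
structure Admissible (s γ : ℝ) (V : Finset Plane) : Prop where
  nonneg : 0 ≤ s
  lt_one : s < 1
  pos : 0 < γ
  le_one : γ ≤ 1
  sep : ∀ u ∈ V, ∀ v ∈ V, u ≠ v → γ ≤ dist u v

/-! ### Possession and relaying over time -/

section Dynamics

variable {M : Type*} (s γ : ℝ) {V : Finset Plane} (src : V) (m : M)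

/-- The states in round `t` after the local computation at its beginning. -/
def updatedB2 (t : ℕ) : V → NodeState M :=
  updated (algorithmB2 M s γ) (blockHolders s γ) t (statesB2 s γ src m t)

/-- The packets transmitted in round `t`. -/
def packetsB2 (t : ℕ) : V → Option (Packet M) :=
  transmissions (algorithmB2 M s γ) (blockHolders s γ) t (statesB2 s γ src m t)

/-- `u` possesses `m` after `t` rounds. -/
def Has (t : ℕ) (u : V) : Prop := (statesB2 s γ src m t u).msg = some m

/-- `u` has sent `m` in the first `t` rounds. -/
def Sent (t : ℕ) (u : V) : Prop := (statesB2 s γ src m t u).sent = true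

variable {s γ src m} {t t' : ℕ} {u v w : V}

theorem updatedB2_eq : updatedB2 s γ src m t u =
    updateTask (blockHolders s γ (statesB2 s γ src m t) u) (statesB2 s γ src m t u)
      (task s γ t) := rfl

theorem packetsB2_eq : packetsB2 s γ src m t u =
    sendTask s γ u (updatedB2 s γ src m t u) (task s γ t) := rfl

theorem statesB2_succ : statesB2 s γ src m (t + 1) u =
    listenTask s γ u (updatedB2 s γ src m t u) (heard s (packetsB2 s γ src m t) u)
      (task s γ t) := rfl

@[simp] theorem updatedB2_msg :
    (updatedB2 s γ src m t u).msg = (statesB2 s γ src m t u).msg := updateTask_msg _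

@[simp] theorem updatedB2_sent :
    (updatedB2 s γ src m t u).sent = (statesB2 s γ src m t u).sent := updateTask_sent _

theorem has_zero : Has s γ src m 0 src := by
  simp [Has, statesB2, states, algorithmB2]

theorem not_sent_zero : ¬ Sent s γ src m 0 u := by
  simp [Sent, statesB2, states, algorithmB2]

/-- The only message around is `m`. -/
theorem msg_eq_none_or_has (t : ℕ) (u : V) :
    (statesB2 s γ src m t u).msg = none ∨ Has s γ src m t u := by
  induction t generalizing u with
  | zero =>
    by_cases h : u = src
    · exact .inr (h ▸ has_zero)
    · left; simp [statesB2, states, algorithmB2, h]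
  | succ t ih =>
    rw [Has, statesB2_succ]
    rcases listenTask_msg (s := s) (γ := γ) (p := (u : Plane)) (a := updatedB2 s γ src m t u)
      (h := heard s (packetsB2 s γ src m t) u) (k := task s γ t) with h | ⟨⟨b, r, hk⟩, m', hm', h⟩
    · rw [h, updatedB2_msg]; exact ih u
    · obtain ⟨-, -, w, -, hw, -⟩ := heard_eq_some_iff.1 hm'
      rw [packetsB2_eq, hk] at hw
      obtain ⟨-, -, -, m'', h1, h2⟩ := sendTask_relay hw
      rw [updatedB2_msg] at h1
      cases h2
      have : m' = m := by
        rcases ih w with h3 | h3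
        · simp [h3] at h1
        · rw [Has, h1] at h3; exact Option.some_inj.1 h3
      right; rw [h, this]

theorem has_iff : Has s γ src m t u ↔ (statesB2 s γ src m t u).msg ≠ none := by
  refine ⟨fun h => by simp [Has] at h; simp [h], fun h => ?_⟩
  exact (msg_eq_none_or_has t u).resolve_left h

theorem Has.succ (h : Has s γ src m t u) : Has s γ src m (t + 1) u := by
  rw [has_iff, statesB2_succ]
  rcases listenTask_msg (s := s) (γ := γ) (p := (u : Plane)) (a := updatedB2 s γ src m t u)
    (h := heard s (packetsB2 s γ src m t) u) (k := task s γ t) with h' | ⟨-, m', -, h'⟩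
  · rw [h', updatedB2_msg]; exact has_iff.1 h
  · simp [h']

theorem Has.mono (htt : t ≤ t') (h : Has s γ src m t u) : Has s γ src m t' u := by
  induction t', htt using Nat.le_induction with
  | base => exact h
  | succ n _ ih => exact ih.succ

theorem sent_succ_iff : Sent s γ src m (t + 1) u ↔ Sent s γ src m t u ∨
    (∃ b r, task s γ t = .relay b r) ∧ packetsB2 s γ src m t u ≠ none := by
  rw [Sent, statesB2_succ, listenTask_sent, updatedB2_sent]; rfl

theorem Sent.mono (htt : t ≤ t') (h : Sent s γ src m t u) : Sent s γ src m t' u := by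
  induction t', htt using Nat.le_induction with
  | base => exact h
  | succ n _ ih => exact sent_succ_iff.2 (.inl ih)

theorem blockHolders_congr {st : V → NodeState M} (h : SameBlock s γ u w) :
    blockHolders s γ st u = blockHolders s γ st w := by
  ext p
  constructor <;> rintro ⟨x, rfl, hx, hm⟩
  · exact ⟨x, rfl, hx.trans h, hm⟩
  · exact ⟨x, rfl, hx.trans h.symm, hm⟩

theorem updatedB2_holders_congr (h : SameBlock s γ u w)
    (hst : (statesB2 s γ src m t u).holders = (statesB2 s γ src m t w).holders) :
    (updatedB2 s γ src m t u).holders = (updatedB2 s γ src m t w).holders := by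
  rw [updatedB2_eq, updatedB2_eq, blockHolders_congr h]
  unfold updateTask
  split
  · rfl
  · exact hst

/-- Nodes of a block refresh in the same rounds with the same side information, so they agree on who
the spokesmen are. -/
theorem holders_congr (h : SameBlock s γ u w) :
    (statesB2 s γ src m t u).holders = (statesB2 s γ src m t w).holders := by
  induction t with
  | zero => rfl
  | succ t ih =>
    rw [statesB2_succ, statesB2_succ, listenTask_holders, listenTask_holders,
      updatedB2_holders_congr h ih]

theorem mem_updatedB2_holders {p : Plane} (hp : p ∈ (updatedB2 s γ src m t u).holders) :
    p ∈ V ∧ SameBlock s γ p u := by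
  -- This handles the refresh at the start of a round, needed both in the induction and for the
  -- final claim.
  have key (t : ℕ) (ih : p ∈ (statesB2 s γ src m t u).holders → p ∈ V ∧ SameBlock s γ p u)
      (hp : p ∈ (updatedB2 s γ src m t u).holders) : p ∈ V ∧ SameBlock s γ p u := by
    rw [updatedB2_eq] at hp
    unfold updateTask at hp
    split at hp
    · obtain ⟨w, rfl, hw, -⟩ := hp
      exact ⟨w.2, hw⟩
    · exact ih hp
  refine key t ?_ hp
  clear hp
  induction t with
  | zero => exact fun hp => absurd hp (Set.notMem_empty _)
  | succ t ih =>
    rw [statesB2_succ, listenTask_holders]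
    exact key t ih

theorem inBlock_of_subset {K : Set Plane} (hA : Admissible s γ V)
    (hK : ∀ p ∈ K, p ∈ V ∧ SameBlock s γ p u) : InBlock s γ K u :=
  ⟨fun p hp => (hK p hp).2, fun p hp q hq => hA.sep p (hK p hp).1 q (hK q hq).1⟩

/-- What a relay transmission looks like. -/
theorem packetsB2_relay {b r : ℕ} (hk : task s γ t = .relay b r)
    (hu : packetsB2 s γ src m t u ≠ none) :
    packetsB2 s γ src m t u = some (.message m) ∧ blockLabel s γ u = b ∧ ¬ Sent s γ src m t u ∧
      ∃ role, (turns (homeRows s γ))[r]? = some role ∧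
        IsSpokesman s γ (updatedB2 s γ src m t u).holders u role := by
  obtain ⟨x, hx⟩ := Option.ne_none_iff_exists'.1 hu
  have hx' := hx
  rw [packetsB2_eq, hk] at hx'
  obtain ⟨h1, h2, h3, m', h4, rfl⟩ := sendTask_relay hx'
  rw [updatedB2_msg] at h4
  rw [updatedB2_sent] at h2
  have : Has s γ src m t u := has_iff.2 (by simp [h4])
  rw [Has, h4] at this
  exact ⟨Option.some_inj.1 this ▸ hx, h1, by simp [Sent, h2], h3⟩

/-- Simultaneous relay transmissions are more than `2` apart. -/
theorem relay_unique (hA : Admissible s γ V) {b r : ℕ} (hk : task s γ t = .relay b r)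
    (hu : packetsB2 s γ src m t u ≠ none) (hw : packetsB2 s γ src m t w ≠ none)
    (hd : dist (u : Plane) w ≤ 2) : u = w := by
  obtain ⟨-, hub, -, role, hr, hur⟩ := packetsB2_relay hk hu
  obtain ⟨-, hwb, -, role', hr', hwr⟩ := packetsB2_relay hk hw
  have hsame := sameBlock_of_dist_le_two hA.nonneg hA.pos hA.le_one (hub.trans hwb.symm) hd
  have : role' = role := Option.some_inj.1 (hr'.symm.trans hr)
  subst this
  rw [← updatedB2_holders_congr hsame (holders_congr hsame)] at hwr
  exact Subtype.ext (IsSpokesman.unique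
    (inBlock_of_subset hA fun p hp => mem_updatedB2_holders hp) hA.pos hur hwr)

/-- A relay transmission reaches all neighbours of the sender. -/
theorem has_of_relay (hA : Admissible s γ V) {b r : ℕ} (hk : task s γ t = .relay b r)
    (hu : packetsB2 s γ src m t u ≠ none) (hadj : (network s V).Adj u v) :
    Has s γ src m (t + 1) v := by
  have hs1 := hA.lt_one
  -- This excludes all three obstacles at once: a second sending neighbour, a swamping node (as `s <
  -- 1`), and `v` itself sending.
  have huniq (w : V) (hw : packetsB2 s γ src m t w ≠ none) (hwv : dist (w : Plane) v ≤ 1) :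
      w = u := by
    refine relay_unique hA hk hw hu ?_
    have := dist_triangle_right (w : Plane) u v
    linarith [hadj.2.2]
  have hrec : Receives s (packetsB2 s γ src m t) v (.message m) := by
    refine ⟨?_, fun w hw => ?_, u, hadj, (packetsB2_relay hk hu).1, fun w hw hne =>
      huniq w hne hw.2.2⟩
    · by_contra hne
      exact hadj.1 (huniq v hne (by simp)).symm
    · by_contra hne
      have := huniq w hne (by linarith)
      subst this
      linarith [hadj.2.1]
  rw [Has, statesB2_succ, heard_eq_some_iff.2 hrec, hk, listenTask_msg_of_heard]

/-- This is why sending once is enough: a node that has sent leaves no neighbour uninformed. -/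
theorem Sent.has (hA : Admissible s γ V) (h : Sent s γ src m t u)
    (hadj : (network s V).Adj u v) : Has s γ src m t v := by
  induction t with
  | zero => exact absurd h not_sent_zero
  | succ t ih =>
    rcases sent_succ_iff.1 h with h | ⟨⟨b, r, hk⟩, hu⟩
    · exact (ih h).succ
    · exact has_of_relay hA hk hu hadj

theorem has_of_silent (h : ∀ u, packetsB2 s γ src m t u = none) (hv : Has s γ src m (t + 1) v) :
    Has s γ src m t v := by
  rw [Has, statesB2_succ] at hv
  rcases listenTask_msg (s := s) (γ := γ) (p := (v : Plane)) (a := updatedB2 s γ src m t v)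
    (h := heard s (packetsB2 s γ src m t) v) (k := task s γ t) with h' | ⟨-, m', h', -⟩
  · rwa [h', updatedB2_msg] at hv
  · obtain ⟨-, -, w, -, hw, -⟩ := heard_eq_some_iff.1 h'
    simp [h w] at hw

/-! ### Phases and iterations -/

theorem numTurns_eq (s γ : ℝ) :
    numTurns s γ = 4 * homeRows s γ + 4 * (2 * homeRows s γ - 1) := by
  simp [numTurns, turns, List.length_flatMap]
  omega

theorem numTurns_pos (hγ : 0 < γ) : 0 < numTurns s γ := by
  have := homeRows_pos s hγ
  rw [numTurns_eq]; omega

variable (s γ) in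
/-- First round of the phase of the blocks with number `b` in iteration `j`. -/
def phaseStart (j b : ℕ) : ℕ := discoveryTime s γ + j * iterationTime s γ + b * numTurns s γ

theorem task_phase (hγ : 0 < γ) (j : ℕ) {b r : ℕ} (hb : b < numBlocks s γ)
    (hr : r < numTurns s γ) : task s γ (phaseStart s γ j b + r) = .relay b r := by
  have h0 : numLabels s γ ≤ discoveryTime s γ := Nat.le_add_right _ _
  have e : phaseStart s γ j b + r - discoveryTime s γ =
      r + numTurns s γ * (b + numBlocks s γ * j) := by
    unfold phaseStart iterationTime
    rw [add_assoc, add_assoc, Nat.add_sub_cancel_left]; ring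
  have h1 : discoveryTime s γ ≤ phaseStart s γ j b + r := by unfold phaseStart; omega
  unfold task
  rw [if_neg (by omega), if_neg (by omega), e, Nat.add_mul_div_left _ _ (numTurns_pos hγ),
    Nat.div_eq_of_lt hr, zero_add, Nat.add_mul_mod_self_left, Nat.mod_eq_of_lt hb,
    Nat.add_mul_mod_self_left, Nat.mod_eq_of_lt hr]

/-- The holder set is refreshed only in turn 0, so spokesmen stay fixed during a phase even if more
nodes receive the message. -/
theorem updatedB2_holders_phase (hγ : 0 < γ) (j : ℕ) {b r : ℕ} (hb : b < numBlocks s γ)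
    (hr : r < numTurns s γ) :
    (updatedB2 s γ src m (phaseStart s γ j b + r) u).holders =
      blockHolders s γ (statesB2 s γ src m (phaseStart s γ j b)) u := by
  induction r with
  | zero =>
    rw [updatedB2_eq, task_phase hγ j hb hr]; rfl
  | succ r ih =>
    rw [updatedB2_eq, task_phase hγ j hb hr, ← ih (by omega), ← add_assoc, statesB2_succ]
    simp [updateTask]

theorem sent_of_isSpokesman (hγ : 0 < γ) (j : ℕ) {role : Role}
    (hrole : role ∈ turns (homeRows s γ))
    (hw : IsSpokesman s γ (blockHolders s γ
      (statesB2 s γ src m (phaseStart s γ j (blockLabel s γ w))) w) w role) :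
    Sent s γ src m (phaseStart s γ j (blockLabel s γ w + 1)) w := by
  have hb := blockLabel_lt s hγ w
  set t := phaseStart s γ j (blockLabel s γ w) with ht
  obtain ⟨r, hr, hrr⟩ := List.getElem_of_mem hrole
  change r < numTurns s γ at hr
  have hlast : t + r + 1 ≤ phaseStart s γ j (blockLabel s γ w + 1) := by
    rw [ht]; unfold phaseStart; rw [add_one_mul]; omega
  refine Sent.mono hlast ?_
  -- At the turn of its role, the spokesman either has already sent or sends now.
  by_cases hs : Sent s γ src m (t + r) w
  · exact sent_succ_iff.2 (.inl hs)
  have hk := task_phase hγ j hb hr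
  rw [← ht] at hk
  refine sent_succ_iff.2 (.inr ⟨⟨_, _, hk⟩, ?_⟩)
  obtain ⟨w', hw', -, hmsg⟩ := hw.mem
  have hhas : Has s γ src m (t + r) w := by
    rw [← Subtype.ext hw']
    exact (has_iff.2 hmsg).mono (Nat.le_add_right _ _)
  rw [packetsB2_eq, hk]
  simp only [sendTask]
  have hget : (turns (homeRows s γ))[r]? = some role := by
    rw [List.getElem?_eq_getElem hr, hrr]
  rw [← updatedB2_holders_phase hγ j hb hr] at hw
  rw [if_pos ⟨rfl, by simpa [Sent] using hs, role, hget, hw⟩, updatedB2_msg, hhas]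
  simp

theorem phaseStart_le (hγ : 0 < γ) (j : ℕ) (u : Plane) :
    phaseStart s γ j (blockLabel s γ u + 1) ≤ phaseStart s γ (j + 1) 0 := by
  have := Nat.mul_le_mul_right (numTurns s γ) (Nat.add_one_le_iff.2 (blockLabel_lt s hγ u))
  simp only [phaseStart, iterationTime, add_one_mul, Nat.zero_mul] at *
  omega

/-- In every iteration the message spreads to all neighbours of the nodes that possess it. -/
theorem has_of_adj (hA : Admissible s γ V) (j : ℕ) (hu : Has s γ src m (phaseStart s γ j 0) u)
    (hadj : (network s V).Adj u v) : Has s γ src m (phaseStart s γ (j + 1) 0) v := by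
  set t := phaseStart s γ j (blockLabel s γ u) with ht
  have hut : Has s γ src m t u := hu.mono (by rw [ht]; unfold phaseStart; omega)
  set K := blockHolders s γ (statesB2 s γ src m t) u with hKdef
  have hK : ∀ p ∈ K, p ∈ V ∧ SameBlock s γ p u := by
    rintro p ⟨w, rfl, hw, -⟩
    exact ⟨w.2, hw⟩
  obtain ⟨w, role, hrole, hw, h1, h2⟩ := (inBlock_of_subset hA hK).exists_spokesman_near hA.pos
    hA.nonneg (V.finite_toSet.subset fun p hp => (hK p hp).1)
    ⟨u, rfl, .refl _ _ _, has_iff.1 hut⟩ hadj.2.1 hadj.2.2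
  lift w to V using (hK w hw.mem).1
  have hsame : SameBlock s γ w u := (hK w hw.mem).2
  have hlab : blockLabel s γ w = blockLabel s γ u := by
    unfold blockLabel; rw [hsame.2.2.1, hsame.2.2.2]
  have hsent : Sent s γ src m (phaseStart s γ j (blockLabel s γ w + 1)) w := by
    refine sent_of_isSpokesman hA.pos j hrole ?_
    rwa [blockHolders_congr hsame, hlab]
  have hwv : (network s V).Adj w v := by
    refine ⟨?_, h1, h2⟩
    rintro rfl
    rw [dist_self] at h1
    linarith [hA.nonneg]
  exact (hsent.has hA hwv).mono (phaseStart_le hA.pos j w)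

theorem has_of_dist_le (hA : Admissible s γ V) (hconn : (network s V).Connected) (j : ℕ)
    (hj : (network s V).dist src v ≤ j) : Has s γ src m (phaseStart s γ j 0) v := by
  induction j generalizing v with
  | zero =>
    have : src = v := hconn.dist_eq_zero_iff.1 (by omega)
    subst this
    exact has_zero.mono (Nat.zero_le _)
  | succ j ih =>
    rcases hj.lt_or_eq with hj | hj
    · refine (ih (by omega)).mono ?_
      unfold phaseStart; rw [add_one_mul]; omega
    · obtain ⟨p, hp⟩ := hconn.exists_walk_length_eq_dist src v
      have hnn : ¬ p.Nil := by
        intro hn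
        rw [← SimpleGraph.Walk.length_eq_zero_iff] at hn
        omega
      have hlen : (network s V).dist src p.penultimate ≤ j := by
        refine (SimpleGraph.dist_le p.dropLast).trans ?_
        simp; omega
      exact has_of_adj hA j (ih hlen) (p.adj_penultimate hnn)

theorem has_diam (hA : Admissible s γ V) (hconn : (network s V).Connected) (v : V) :
    Has s γ src m (phaseStart s γ (network s V).diam 0) v :=
  -- Connectivity makes the extended diameter finite; otherwise `diam` would take its default value
  -- 0.
  have : Nonempty V := ⟨src⟩
  has_of_dist_le hA hconn _
    (SimpleGraph.dist_le_diam (SimpleGraph.connected_iff_ediam_ne_top.1 hconn))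

theorem exists_phase (j : ℕ) {i : ℕ} (hi : i < iterationTime s γ) :
    ∃ b < numBlocks s γ, ∃ r < numTurns s γ,
      discoveryTime s γ + j * iterationTime s γ + i = phaseStart s γ j b + r := by
  have hn : 0 < numTurns s γ := Nat.pos_of_ne_zero fun h => by simp [iterationTime, h] at hi
  refine ⟨i / numTurns s γ, (Nat.div_lt_iff_lt_mul hn).2 hi, i % numTurns s γ,
    Nat.mod_lt _ hn, ?_⟩
  have := Nat.div_add_mod' i (numTurns s γ)
  unfold phaseStart; omega

/-- Once all nodes possess the message, there is at most one more iteration with transmissions. -/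
theorem silent_of_forall_has (hA : Admissible s γ V) (j : ℕ)
    (hall : ∀ v, Has s γ src m (phaseStart s γ j 0) v) :
    SilentIteration s γ src m (j + 1) := by
  intro i hi u hu
  obtain ⟨b, hb, r, hr, e⟩ := exists_phase (j + 1) hi
  rw [e] at hu
  obtain ⟨-, hub, hns, role, hrole, hsp⟩ :=
    packetsB2_relay (task_phase hA.pos (j + 1) hb hr) hu
  rw [updatedB2_holders_phase hA.pos (j + 1) hb hr] at hsp
  have hfull (t : ℕ) (ht : phaseStart s γ j 0 ≤ t) :
      blockHolders s γ (statesB2 s γ src m t) u =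
        {p | ∃ w : V, (w : Plane) = p ∧ SameBlock s γ w u} := by
    ext p
    simp only [blockHolders, Set.mem_ofPred_eq, ← has_iff]
    simp [fun w => (hall w).mono ht]
  have h1 : phaseStart s γ j 0 ≤ phaseStart s γ (j + 1) b := by
    unfold phaseStart; rw [add_one_mul]; omega
  have h2 : phaseStart s γ j 0 ≤ phaseStart s γ j (blockLabel s γ u) := by
    unfold phaseStart; omega
  -- With all nodes informed, the holder set is the same in iterations `j` and `j + 1`; so `u` had
  -- this role in iteration `j` and sent by its end.
  rw [hfull _ h1, ← hfull _ h2] at hsp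
  refine hns ((sent_of_isSpokesman hA.pos j (List.mem_of_getElem? hrole) hsp).mono ?_)
  have := phaseStart_le (s := s) hA.pos j u
  have : phaseStart s γ (j + 1) 0 ≤ phaseStart s γ (j + 1) b + r := by unfold phaseStart; omega
  omega

/-- After a silent iteration all nodes possess the message. -/
theorem has_of_silentIteration (hA : Admissible s γ V) (hconn : (network s V).Connected) {j : ℕ}
    (hj : SilentIteration s γ src m j) (v : V) : Has s γ src m (phaseStart s γ (j + 1) 0) v := by
  have hle : phaseStart s γ j 0 ≤ phaseStart s γ (j + 1) 0 := by
    unfold phaseStart; rw [add_one_mul]; omega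
  -- In silence nobody gains the message, so possession can be pulled back to the start of the
  -- iteration; with `has_of_adj`, the initial holders are closed under adjacency.
  have hback (v : V) (i : ℕ) (hi : i ≤ iterationTime s γ)
      (hv : Has s γ src m (phaseStart s γ j 0 + i) v) : Has s γ src m (phaseStart s γ j 0) v := by
    induction i with
    | zero => exact hv
    | succ i ih =>
      refine ih (by omega) (has_of_silent (fun u => ?_) hv)
      rw [phaseStart, Nat.zero_mul, add_zero]
      exact not_not.1 (hj i (by omega) u)
  have hreach : ∀ (u v : V), (network s V).Walk u v →
      Has s γ src m (phaseStart s γ j 0) u → Has s γ src m (phaseStart s γ j 0) v := by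
    intro u v p
    induction p with
    | nil => exact id
    | cons hadj _ ih =>
      refine fun hu => ih (hback _ _ le_rfl ?_)
      have := has_of_adj hA j hu hadj
      have e : phaseStart s γ (j + 1) 0 = phaseStart s γ j 0 + iterationTime s γ := by
        unfold phaseStart; rw [add_one_mul]; omega
      rwa [e] at this
  obtain ⟨p⟩ := hconn src v
  exact (hreach _ _ p (has_zero.mono (Nat.zero_le _))).mono hle

theorem exists_endsAt (hA : Admissible s γ V) (hconn : (network s V).Connected) :
    ∃ T, EndsAt s γ src m T ∧ (∀ u, Has s γ src m T u) ∧
      T ≤ discoveryTime s γ + ((network s V).diam + 2) * iterationTime s γ := by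
  classical
  have hsil := silent_of_forall_has (src := src) (m := m) hA _ (has_diam hA hconn)
  have hex : ∃ j, SilentIteration s γ src m j := ⟨_, hsil⟩
  refine ⟨phaseStart s γ (Nat.find hex + 1) 0, ⟨Nat.find hex, Nat.find_spec hex,
    fun i hi => Nat.find_min hex hi, by simp [phaseStart]⟩,
    has_of_silentIteration hA hconn (Nat.find_spec hex), ?_⟩
  -- Iteration `diam + 1` is silent; counting from 0 gives at most `diam + 2` iterations.
  have : Nat.find hex + 1 ≤ (network s V).diam + 2 := by
    have := Nat.find_min' hex hsil
    omega
  have := Nat.mul_le_mul_right (iterationTime s γ) this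
  simp only [phaseStart]
  omega

end Dynamics

/-! ### Running time -/

section Bounds

variable {s γ : ℝ}

/-- Since `l < 1`, rounding up costs at most `1/l`. -/
theorem blockRows_le (hs : 0 ≤ s) (hγ : 0 < γ) (hγ1 : γ ≤ 1) :
    (blockRows s γ : ℝ) ≤ 4 / blockLen s γ := by
  have hl := blockLen_pos s hγ
  have h1 : 1 ≤ 1 / blockLen s γ := by
    rw [le_div_iff₀ hl]; linarith [blockLen_lt_one hs hγ1]
  have := (Nat.ceil_lt_add_one (a := 3 / blockLen s γ) (by positivity)).le
  have e : 4 / blockLen s γ = 3 / blockLen s γ + 1 / blockLen s γ := by ring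
  rw [blockRows, e]
  linarith

theorem one_le_sqrt_two_mul (s : ℝ) (hγ : 0 < γ) : 1 ≤ √2 * blockLen s γ / γ := by
  have := homeLen_le_blockLen s γ
  rw [homeLen, div_le_iff₀ (by positivity)] at this
  rw [le_div_iff₀ hγ]
  linarith

/-- The rounded quantity is at least 1, so the ceiling at most doubles it, and `2√2 ≤ 3`. -/
theorem homeRows_le (s : ℝ) (hγ : 0 < γ) : (homeRows s γ : ℝ) ≤ 3 * (blockLen s γ / γ) := by
  have hl := blockLen_pos s hγ
  have h1 := one_le_sqrt_two_mul s hγ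
  have := (Nat.ceil_lt_add_one (a := √2 * blockLen s γ / γ) (by positivity)).le
  have h2 : √2 ≤ 3 / 2 := by rw [Real.sqrt_le_left] <;> norm_num
  have h3 : √2 * blockLen s γ / γ ≤ 3 / 2 * (blockLen s γ / γ) := by
    rw [mul_div_assoc]; gcongr
  rw [homeRows]
  linarith

theorem numBlocks_le (hs : 0 ≤ s) (hγ : 0 < γ) (hγ1 : γ ≤ 1) :
    (numBlocks s γ : ℝ) ≤ 16 / blockLen s γ ^ 2 := by
  have := pow_le_pow_left₀ (Nat.cast_nonneg _) (blockRows_le hs hγ hγ1) 2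
  rw [div_pow] at this
  rw [numBlocks]; push_cast; linarith

theorem numLabels_le (hs : 0 ≤ s) (hγ : 0 < γ) (hγ1 : γ ≤ 1) :
    (numLabels s γ : ℝ) ≤ 144 * (1 / γ) ^ 2 := by
  have hl := blockLen_pos s hγ
  have h2 := pow_le_pow_left₀ (Nat.cast_nonneg _) (homeRows_le s hγ) 2
  rw [numLabels, numHomes]; push_cast
  calc _ ≤ 16 / blockLen s γ ^ 2 * (3 * (blockLen s γ / γ)) ^ 2 :=
        mul_le_mul (numBlocks_le hs hγ hγ1) h2 (by positivity) (by positivity)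
    _ = _ := by field_simp; norm_num

theorem iterationTime_le (hs : 0 ≤ s) (hγ : 0 < γ) (hγ1 : γ ≤ 1) :
    (iterationTime s γ : ℝ) ≤ 576 * (1 / γ / blockLen s γ) := by
  have hl := blockLen_pos s hγ
  have h2 : (numTurns s γ : ℝ) ≤ 12 * (3 * (blockLen s γ / γ)) := by
    have h3 : numTurns s γ ≤ 12 * homeRows s γ := by rw [numTurns_eq]; omega
    have h4 : (numTurns s γ : ℝ) ≤ 12 * homeRows s γ := by exact_mod_cast h3
    linarith [homeRows_le s hγ]
  rw [iterationTime]; push_cast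
  calc _ ≤ 16 / blockLen s γ ^ 2 * (12 * (3 * (blockLen s γ / γ))) :=
        mul_le_mul (numBlocks_le hs hγ hγ1) h2 (by positivity) (by positivity)
    _ = _ := by field_simp; norm_num

theorem time_le (hs : 0 ≤ s) (hγ : 0 < γ) (hγ1 : γ ≤ 1) (D : ℕ) :
    ((discoveryTime s γ + (D + 2) * iterationTime s γ : ℕ) : ℝ) ≤
      30000 * (D * (1 / γ) / blockLen s γ + (1 / γ) ^ 4) := by
  have hl := blockLen_pos s hγ
  have hn := numLabels_le hs hγ hγ1
  have hi := iterationTime_le hs hγ hγ1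
  have hg : 1 ≤ 1 / γ := by rw [le_div_iff₀ hγ]; linarith
  -- From `l ≥ γ/√2`; this absorbs the two iterations beyond `D` into `g⁴`. The coefficient of `g⁴`
  -- is then at most `144² + 144 + 4 · 576 = 23184`.
  have hgl : 1 / blockLen s γ ≤ 2 * (1 / γ) := by
    have h2 : √2 ≤ 2 := by rw [Real.sqrt_le_left] <;> norm_num
    have h1 := one_le_sqrt_two_mul s hγ
    rw [div_le_iff₀ hl]
    calc 1 ≤ √2 * blockLen s γ / γ := h1
      _ = √2 * (1 / γ) * blockLen s γ := by ring
      _ ≤ _ := by gcongr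
  set g := 1 / γ
  set n : ℝ := (numLabels s γ : ℝ)
  have hn0 : 0 ≤ n := Nat.cast_nonneg _
  have hg2 : g ^ 2 ≤ g ^ 4 := pow_le_pow_right₀ hg (by norm_num)
  have hnn : n * n ≤ 144 * g ^ 2 * (144 * g ^ 2) := mul_le_mul hn hn hn0 (by positivity)
  have hgg : g / blockLen s γ ≤ 2 * g ^ 2 := by
    calc g / blockLen s γ = g * (1 / blockLen s γ) := by ring
      _ ≤ g * (2 * g) := by gcongr
      _ = _ := by ring
  have hD := mul_le_mul_of_nonneg_left hi (by positivity : (0 : ℝ) ≤ D + 2)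
  have e : (D : ℝ) * g / blockLen s γ = D * (g / blockLen s γ) := by ring
  have hD0 : 0 ≤ (D : ℝ) * (g / blockLen s γ) := by positivity
  rw [discoveryTime, e]; push_cast
  nlinarith

end Bounds

end Swamping
end

theorem theorem4 :
    ∃ C : ℝ, 0 < C ∧
      ∀ (s γ : ℝ), 0 ≤ s → s < 1 → 0 < γ → γ ≤ 1 →
      ∀ (V : Finset Swamping.Plane),
        (∀ u ∈ V, ∀ v ∈ V, u ≠ v → γ ≤ dist u v) →
        (Swamping.network s V).Connected →
      ∀ (M : Type*) (m : M) (src : V) (g l : ℝ),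
        g = 1 / γ →
        l = max ((1 - s) / (3 * √2)) (γ / √2) →
        ∃ T : ℕ, Swamping.EndsAt s γ src m T ∧
          (∀ u : V, (Swamping.statesB2 s γ src m T u).msg = some m) ∧
          (T : ℝ) ≤ C * ((Swamping.network s V).diam * g / l + g ^ 4) := by
  refine ⟨30000, by norm_num, ?_⟩
  rintro s γ hs hs1 hγ hγ1 V hsep hconn M m src g l rfl rfl
  obtain ⟨T, hT, hall, hle⟩ :=
    Swamping.exists_endsAt (src := src) (m := m) ⟨hs, hs1, hγ, hγ1, hsep⟩ hconn
  exact ⟨T, hT, hall, (Nat.cast_le.2 hle).trans (Swamping.time_le hs hγ hγ1 _)⟩
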